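/- **Conventions.** A topological space $X$ is *pseudocompact* if each locally finite open cover of $X$ is finite; a subset is pseudocompact if it is so in the subspace topology. A semigroup $S$ is *inverse* if for every $x\in S$ there is a unique $x^{-1}\in S$ with $xx^{-1}x=x$ and $x^{-1}xx^{-1}=x^{-1}$; a *Hausdorff topological inverse semigroup* is an inverse semigroup with a Hausdorff topology in which multiplication and inversion are continuous. $E(S)$ denotes the set of idempotents of $S$, and "non-zero" means "not a zero element of $S$". An idempotent $e$ is *primitive* if it is non-zero and every non-zero idempotent $f$ with $ef=fe=f$ equals $e$. An inverse semigroup is *primitive* if it has more than one element and all its non-zero idempotents are primitive. Green's relations are given by $a\mathscr L b\iff \{a\}\cup Sa=\{b\}\cup Sb$, $a\mathscr R b\iff \{a\}\cup aS=\{b\}\cup bS$, $\mathscr H=\mathscr L\cap\mathscr R$; a *non-zero $\mathscr H$-class* is the $\mathscr H$-class of a non-zero element. A *Brandt semigroup* is an inverse semigroup $B$ that is completely $0$-simple: it has a zero $0$, $B\cdot B\neq\{0\}$, its only non-empty two-sided ideals are $\{0\}$ and $B$, and it contains a primitive idempotent. *Maximal* subgroups (resp. maximal Brandt subsemigroups)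 of $S$ are the maximal elements, with respect to inclusion, among the subsemigroups of $S$ that are groups (resp. Brandt semigroups). **Proposition 2.1.** Let $S$ be a Hausdorff pseudocompact primitive topological inverse semigroup. Then: (i) every non-zero idempotent of $S$ is an isolated point of the subspace $E(S)$, and $E(S)$ is a compact semilattice (it is compact, closed under multiplication, and its elements commute); (ii) every non-zero $\mathscr H$-class of $S$ is a pseudocompact open-and-closed subset of $S$; (iii) every maximal subgroup of $S$ is a pseudocompact subspace of $S$; (iv) every maximal Brandt subsemigroup of $S$ is a pseudocompact space and has finitely many idempotents. -/

import Mathlib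

namespace PseudocompactPrimitive

/-- A topological space is pseudocompact if each locally finite open cover of it is finite. -/
def IsPseudocompactSpace (X : Type*) [TopologicalSpace X] : Prop :=
  ∀ C : Set (Set X), (∀ U ∈ C, IsOpen U) → ⋃₀ C = Set.univ →
    LocallyFinite (fun U : C => (U : Set X)) → C.Finite

/-- A semigroup is inverse if every `x` has exactly one inverse, that is, exactly one `y` with
`x * y * x = x` and `y * x * y = y`. -/
def IsInverseSemigroup (S : Type*) [Semigroup S] : Prop :=
  ∀ x : S, ∃! y : S, x * y * x = x ∧ y * x * y = y

/-- The inversion `x ↦ x⁻¹` of an inverse semigroup. -/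
noncomputable def inversion {S : Type*} [Semigroup S] (h : IsInverseSemigroup S) (x : S) : S :=
  (h x).choose

theorem inversion_spec {S : Type*} [Semigroup S] (h : IsInverseSemigroup S) (x : S) :
    x * inversion h x * x = x ∧ inversion h x * x * inversion h x = inversion h x :=
  (h x).choose_spec.1

/-- A topological inverse semigroup: a Hausdorff space with a continuous semigroup operation, in
which every element has a unique inverse and the inversion is continuous. -/
def IsTopologicalInverseSemigroup (S : Type*) [Semigroup S] [TopologicalSpace S] : Prop :=
  T2Space S ∧ ContinuousMul S ∧ ∃ h : IsInverseSemigroup S, Continuous (inversion h)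

/-- `z` is a zero of the semigroup. A semigroup has at most one zero, and may have none. -/
def IsZeroElement {S : Type*} [Semigroup S] (z : S) : Prop :=
  ∀ x : S, z * x = z ∧ x * z = z

/-- The set `E(S)` of idempotents. -/
def idempotents (S : Type*) [Semigroup S] : Set S :=
  {e | IsIdempotentElem e}

/-- A primitive idempotent: a minimal element, for the natural order
`f ≤ e ↔ e * f = f ∧ f * e = f`, of the set of all idempotents that are not a zero of `S`
(this is the set of all idempotents if `S` has no zero). -/
def IsPrimitiveIdempotent {S : Type*} [Semigroup S] (e : S) : Prop :=
  IsIdempotentElem e ∧ ¬ IsZeroElement e ∧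
    ∀ f : S, IsIdempotentElem f → ¬ IsZeroElement f → e * f = f ∧ f * e = f → f = e

/-- A primitive inverse semigroup: a non-trivial inverse semigroup all of whose non-zero
idempotents are primitive. -/
def IsPrimitiveInverseSemigroup (S : Type*) [Semigroup S] : Prop :=
  Nontrivial S ∧ IsInverseSemigroup S ∧
    ∀ e : S, IsIdempotentElem e → ¬ IsZeroElement e → IsPrimitiveIdempotent e

/-- A (non-empty, two-sided) ideal of a semigroup. -/
def IsSemigroupIdeal {S : Type*} [Semigroup S] (I : Set S) : Prop :=
  I.Nonempty ∧ ∀ a ∈ I, ∀ s : S, s * a ∈ I ∧ a * s ∈ I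

/-- A completely `0`-simple semigroup: it has a zero, not all products are zero, the only ideals
are `{0}` and the whole semigroup, and there is a primitive idempotent. -/
def IsCompletelyZeroSimple (S : Type*) [Semigroup S] : Prop :=
  (∃ z : S, IsZeroElement z ∧ (∃ x y : S, x * y ≠ z) ∧
    ∀ I : Set S, IsSemigroupIdeal I → I = {z} ∨ I = Set.univ) ∧
  ∃ e : S, IsPrimitiveIdempotent e

/-- A Brandt semigroup: a completely `0`-simple inverse semigroup. -/
def IsBrandtSemigroup (S : Type*) [Semigroup S] : Prop :=
  IsInverseSemigroup S ∧ IsCompletelyZeroSimple S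

/-- A maximal Brandt subsemigroup: maximal for inclusion among the subsemigroups that are Brandt
semigroups. -/
def IsMaximalBrandtSubsemigroup {S : Type*} [Semigroup S] (T : Subsemigroup S) : Prop :=
  Maximal (fun T' : Subsemigroup S => IsBrandtSemigroup T') T

/-- The subsemigroup `H` is a group under the multiplication of `S`; its identity may be any
idempotent of `S`. -/
def IsSubgroupOf {S : Type*} [Semigroup S] (H : Subsemigroup S) : Prop :=
  ∃ e ∈ H, ∀ x ∈ H, e * x = x ∧ x * e = x ∧ ∃ y ∈ H, x * y = e ∧ y * x = e

/-- A maximal subgroup of a semigroup: maximal for inclusion among its subgroups. -/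
def IsMaximalSubgroup {S : Type*} [Semigroup S] (H : Subsemigroup S) : Prop :=
  Maximal (fun H' : Subsemigroup S => IsSubgroupOf H') H

/-- Green's relation `L`: `{a} ∪ Sa = {b} ∪ Sb`. -/
def GreenL {S : Type*} [Semigroup S] (a b : S) : Prop :=
  {a} ∪ Set.range (fun s : S => s * a) = {b} ∪ Set.range (fun s : S => s * b)

/-- Green's relation `R`: `{a} ∪ aS = {b} ∪ bS`. -/
def GreenR {S : Type*} [Semigroup S] (a b : S) : Prop :=
  {a} ∪ Set.range (fun s : S => a * s) = {b} ∪ Set.range (fun s : S => b * s)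

/-- The class of `a` for Green's relation `H`, the intersection of `L` and `R`. -/
def greenHClass {S : Type*} [Semigroup S] (a : S) : Set S :=
  {b | GreenL a b ∧ GreenR a b}

end PseudocompactPrimitive

open PseudocompactPrimitive

/-! In a primitive inverse semigroup two idempotents with non-zero product coincide
(`eq_of_mul_ne_zero`). For a non-zero idempotent `e`, the open set of all `f` with `e * f` non-zero
therefore meets `E(S)` only in `e`, so `e` is isolated there. The continuous maps `x ↦ x * x⁻¹` and
`x ↦ x⁻¹ * x` into `E(S)` then have clopen fibres over non-zero idempotents (`isClopen_preimage`),
and a non-zero `H`-class is an intersection of two such fibres. Clopen subsets inherit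
pseudocompactness, and maximal subgroups are `H`-classes of idempotents.

All finiteness comes from one fact: a locally constant map on a pseudocompact space has finite
range. It shows that only finitely many idempotents lie outside a given neighbourhood of zero, so
`E(S)` is compact. A maximal Brandt subsemigroup is an ideal `SeS`, and each of its non-zero
idempotents is `a⁻¹ * a` for some `a` with `a * a⁻¹ = e`, so these are finitely many too. Away from
zero, `SeS` is then a finite union of clopen fibres. -/

namespace PseudocompactPrimitive

/-! ### Pseudocompact spaces -/

section Pseudocompact

variable {X : Type*} [TopologicalSpace X]

theorem IsPseudocompactSpace.finite_nonempty (hX : IsPseudocompactSpace X) {ι : Type*}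
    {f : ι → Set X} (ho : ∀ i, IsOpen (f i)) (hf : LocallyFinite f) :
    {i | (f i).Nonempty}.Finite := by
  -- Adjoining the whole space turns the family into a cover.
  have hg : LocallyFinite (Option.elim' Set.univ f) := hf.option_elim' Set.univ
  set g : Option ι → Set X := Option.elim' Set.univ f with hgdef
  have hfin : (Set.range g).Finite := by
    refine hX _ ?_ ?_ hg.on_range
    · rintro _ ⟨i, rfl⟩
      cases i with
      | none => exact isOpen_univ
      | some i => exact ho i
    · exact Set.eq_univ_of_univ_subset (Set.subset_sUnion_of_mem ⟨none, rfl⟩)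
  -- A non-empty set is repeated only finitely often, by point-finiteness, so finiteness passes from
  -- sets to indices.
  have hpre : (g ⁻¹' (Set.range g \ {∅})).Finite := by
    refine Set.Finite.preimage' (hfin.subset Set.sdiff_subset) ?_
    rintro U ⟨-, hU⟩
    obtain ⟨x, hx⟩ := Set.nonempty_iff_ne_empty.2 hU
    refine (hg.point_finite x).subset ?_
    intro i hi
    have hi' : g i = U := hi
    simpa [hi'] using hx
  refine (hpre.preimage (f := some) (Option.some_injective ι).injOn).subset ?_
  intro i hi
  exact ⟨⟨some i, rfl⟩, hi.ne_empty⟩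

theorem isPseudocompactSpace_of_finite_nonempty
    (h : ∀ C : Set (Set X), (∀ U ∈ C, IsOpen U) → LocallyFinite (fun U : C => (U : Set X)) →
      {U : C | (U : Set X).Nonempty}.Finite) : IsPseudocompactSpace X := by
  intro C ho _ hl
  refine (((h C ho hl).image Subtype.val).insert ∅).subset ?_
  intro U hU
  rcases U.eq_empty_or_nonempty with h0 | h0
  · exact Or.inl h0
  · exact Or.inr ⟨⟨U, hU⟩, h0, rfl⟩

theorem isPseudocompactSpace_of_finite [Finite X] : IsPseudocompactSpace X :=
  fun _ _ _ _ => Set.toFinite _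

theorem IsPseudocompactSpace.of_isClopen (hX : IsPseudocompactSpace X) {A : Set X}
    (hA : IsClopen A) : IsPseudocompactSpace A := by
  refine isPseudocompactSpace_of_finite_nonempty fun C ho hl => ?_
  have hfin := hX.finite_nonempty (f := fun U : C => Subtype.val '' (U : Set A))
    (fun U => hA.isOpen.isOpenMap_subtype_val _ (ho U U.2)) ?_
  · refine hfin.subset fun U hU => ?_
    exact Set.Nonempty.image _ hU
  · intro x
    by_cases hx : x ∈ A
    · obtain ⟨V, hV, hVf⟩ := hl ⟨x, hx⟩
      refine ⟨Subtype.val '' V, hA.isOpen.isOpenMap_subtype_val.image_mem_nhds hV,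
        hVf.subset ?_⟩
      rintro U ⟨_, ⟨y, hy, rfl⟩, ⟨w, hw, hwy⟩⟩
      exact ⟨y, hy, Subtype.val_injective hwy ▸ hw⟩
    · refine ⟨Aᶜ, hA.isClosed.isOpen_compl.mem_nhds hx, Set.finite_empty.subset ?_⟩
      rintro U ⟨_, ⟨y, -, rfl⟩, hy⟩
      exact hy y.2

/-- A non-empty subset of the union meets one of the two pieces, so it suffices to restrict the
family to each. -/
theorem IsPseudocompactSpace.union {A B : Set X} (hA : IsPseudocompactSpace A)
    (hB : IsPseudocompactSpace B) : IsPseudocompactSpace (A ∪ B : Set X) := by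
  refine isPseudocompactSpace_of_finite_nonempty fun C ho hl => ?_
  have key : ∀ D : Set X, IsPseudocompactSpace D → ∀ hD : D ⊆ A ∪ B,
      {U : C | (Set.inclusion hD ⁻¹' (U : Set (A ∪ B : Set X))).Nonempty}.Finite :=
    fun D hpc hD => hpc.finite_nonempty
      (fun U => (ho U U.2).preimage (continuous_inclusion hD))
      (hl.preimage_continuous (continuous_inclusion hD))
  refine ((key A hA Set.subset_union_left).union (key B hB Set.subset_union_right)).subset ?_
  rintro U ⟨⟨x, hx | hx⟩, hxU⟩
  · exact Or.inl ⟨⟨x, hx⟩, hxU⟩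
  · exact Or.inr ⟨⟨x, hx⟩, hxU⟩

/-- The fibres form a locally finite family of open sets. -/
theorem IsPseudocompactSpace.finite_range (hX : IsPseudocompactSpace X) {Y : Type*} {g : X → Y}
    (hg : IsLocallyConstant g) : (Set.range g).Finite := by
  refine (hX.finite_nonempty (f := fun y => g ⁻¹' {y}) (fun y => hg _) ?_).subset ?_
  · intro x
    refine ⟨g ⁻¹' {g x}, (hg _).mem_nhds rfl, (Set.finite_singleton (g x)).subset ?_⟩
    rintro y ⟨w, hw, hw'⟩
    exact hw.symm.trans hw'
  · rintro _ ⟨x, rfl⟩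
    exact ⟨x, rfl⟩

end Pseudocompact

/-! ### Inverse semigroups, Green's relations and maximal subgroups -/

section Algebra

variable {S : Type*} [Semigroup S]

theorem IsZeroElement.eq {y z : S} (hy : IsZeroElement y) (hz : IsZeroElement z) : y = z :=
  (hy z).1.symm.trans (hz y).2

theorem mul_inversion_mul (h : IsInverseSemigroup S)
    (x : S) : x * inversion h x * x = x := (inversion_spec h x).1

theorem inversion_mul_inversion (h : IsInverseSemigroup S)
    (x : S) : inversion h x * x * inversion h x = inversion h x :=
  (inversion_spec h x).2

theorem eq_inversion (h : IsInverseSemigroup S)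
    {x y : S} (h1 : x * y * x = x) (h2 : y * x * y = y) : y = inversion h x :=
  (h x).unique ⟨h1, h2⟩ (inversion_spec h x)

theorem isIdempotentElem_mul_inversion (h : IsInverseSemigroup S)
    (x : S) : IsIdempotentElem (x * inversion h x) := by
  rw [IsIdempotentElem, ← mul_assoc, mul_inversion_mul]

theorem isIdempotentElem_inversion_mul (h : IsInverseSemigroup S)
    (x : S) : IsIdempotentElem (inversion h x * x) := by
  rw [IsIdempotentElem, ← mul_assoc, inversion_mul_inversion]

theorem inversion_eq_self (h : IsInverseSemigroup S)
    {e : S} (he : IsIdempotentElem e) : inversion h e = e :=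
  (eq_inversion h (by rw [he.eq, he.eq]) (by rw [he.eq, he.eq])).symm

/-- If `z` is the inverse of `e * f`, then so is `f * z * e`. Uniqueness gives `z = f * z * e`,
which makes `z` idempotent, hence its own inverse, hence equal to `e * f`. -/
theorem isIdempotentElem_mul (h : IsInverseSemigroup S)
    {e f : S} (he : IsIdempotentElem e) (hf : IsIdempotentElem f) :
    IsIdempotentElem (e * f) := by
  have he' (y : S) : e * (e * y) = e * y := by rw [← mul_assoc, he.eq]
  have hf' (y : S) : f * (f * y) = f * y := by rw [← mul_assoc, hf.eq]
  obtain ⟨z, hz⟩ : ∃ z, z = inversion h (e * f) := ⟨_, rfl⟩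
  have h1 : e * f * z * (e * f) = e * f := hz ▸ mul_inversion_mul h (e * f)
  have h2 : z * (e * f) * z = z := hz ▸ inversion_mul_inversion h (e * f)
  simp only [mul_assoc] at h1 h2
  have h2' (y : S) : z * (e * (f * (z * y))) = z * y := by
    rw [← mul_assoc f, ← mul_assoc e, ← mul_assoc z, h2]
  have h3 : f * z * e = z := by
    rw [hz]
    refine eq_inversion h ?_ ?_ <;> rw [← hz]
    · simp only [mul_assoc, he', hf', h1]
    · simp only [mul_assoc, he', hf', h2']
  have hzi : IsIdempotentElem z := by
    rw [IsIdempotentElem]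
    nth_rw 1 2 [← h3]
    simp only [mul_assoc, h2']
    rw [← mul_assoc, h3]
  have h4 : e * f = inversion h z :=
    eq_inversion h (by simp only [mul_assoc, h2]) (by simp only [mul_assoc, h1])
  rw [h4, inversion_eq_self h hzi]
  exact hzi

/-- Both `f * e` and the idempotent `e * f` itself are inverses of `e * f`. -/
theorem idempotents_comm (h : IsInverseSemigroup S)
    {e f : S} (he : IsIdempotentElem e) (hf : IsIdempotentElem f) :
    e * f = f * e := by
  have h1 := isIdempotentElem_mul h he hf
  have h2 := isIdempotentElem_mul h hf he
  have he' (y : S) : e * (e * y) = e * y := by rw [← mul_assoc, he.eq]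
  have hf' (y : S) : f * (f * y) = f * y := by rw [← mul_assoc, hf.eq]
  have h3 : f * e = inversion h (e * f) := by
    refine eq_inversion h ?_ ?_
    · simpa only [IsIdempotentElem, mul_assoc, he', hf'] using h1
    · simpa only [IsIdempotentElem, mul_assoc, he', hf'] using h2
  rw [h3, inversion_eq_self h h1]

theorem mul_inversion_mul_eq_of_eq_mul (h : IsInverseSemigroup S) {a b s : S} (hab : a = s * b) :
    a * (inversion h b * b) = a := by
  rw [hab, mul_assoc, ← mul_assoc b, mul_inversion_mul]

theorem mul_inversion_mul_eq_of_eq_mul' (h : IsInverseSemigroup S) {a b s : S} (hab : a = b * s) :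
    b * inversion h b * a = a := by
  rw [hab, ← mul_assoc, mul_inversion_mul]

theorem greenL_iff (h : IsInverseSemigroup S)
    {a b : S} : GreenL a b ↔ inversion h a * a = inversion h b * b := by
  constructor
  · have key : ∀ {a b : S}, GreenL a b →
        inversion h a * a * (inversion h b * b) = inversion h a * a := by
      intro a b hab
      have ha : a ∈ {b} ∪ Set.range (fun s : S => s * b) := hab ▸ Or.inl rfl
      have : ∃ s, a = s * b := by
        rcases ha with ha | ⟨s, hs⟩
        · exact ⟨b * inversion h b, by rw [mul_inversion_mul]; exact ha⟩
        · exact ⟨s, hs.symm⟩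
      obtain ⟨s, hs⟩ := this
      rw [mul_assoc, mul_inversion_mul_eq_of_eq_mul h hs]
    intro hab
    rw [← key hab, idempotents_comm h (isIdempotentElem_inversion_mul h a)
      (isIdempotentElem_inversion_mul h b), key hab.symm]
  · have key : ∀ {a b : S}, inversion h a * a = inversion h b * b →
        {a} ∪ Set.range (fun s : S => s * a) ⊆ {b} ∪ Set.range (fun s : S => s * b) := by
      intro a b hab
      have ha : a = a * inversion h b * b := by
        rw [mul_assoc, ← hab, ← mul_assoc, mul_inversion_mul]
      rintro x (rfl | ⟨s, rfl⟩)
      · exact Or.inr ⟨_, ha.symm⟩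
      · exact Or.inr ⟨s * (a * inversion h b), by
          simp only [mul_assoc] at ha ⊢; rw [← ha]⟩
    intro hab
    exact (key hab).antisymm (key hab.symm)

theorem greenR_iff (h : IsInverseSemigroup S)
    {a b : S} : GreenR a b ↔ a * inversion h a = b * inversion h b := by
  constructor
  · have key : ∀ {a b : S}, GreenR a b →
        b * inversion h b * (a * inversion h a) = a * inversion h a := by
      intro a b hab
      have ha : a ∈ {b} ∪ Set.range (fun s : S => b * s) := hab ▸ Or.inl rfl
      have : ∃ s, a = b * s := by
        rcases ha with ha | ⟨s, hs⟩
        · exact ⟨inversion h b * b, by rw [← mul_assoc, mul_inversion_mul]; exact ha⟩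
        · exact ⟨s, hs.symm⟩
      obtain ⟨s, hs⟩ := this
      rw [← mul_assoc, mul_inversion_mul_eq_of_eq_mul' h hs]
    intro hab
    rw [← key hab, idempotents_comm h (isIdempotentElem_mul_inversion h b)
      (isIdempotentElem_mul_inversion h a), key hab.symm]
  · have key : ∀ {a b : S}, a * inversion h a = b * inversion h b →
        {a} ∪ Set.range (fun s : S => a * s) ⊆ {b} ∪ Set.range (fun s : S => b * s) := by
      intro a b hab
      have ha : a = b * (inversion h b * a) := by
        rw [← mul_assoc, ← hab, mul_inversion_mul]
      rintro x (rfl | ⟨s, rfl⟩)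
      · exact Or.inr ⟨_, ha.symm⟩
      · exact Or.inr ⟨inversion h b * a * s, by
          change b * (inversion h b * a * s) = a * s
          rw [← mul_assoc b, ← ha]⟩
    intro hab
    exact (key hab).antisymm (key hab.symm)

theorem greenHClass_eq (h : IsInverseSemigroup S) (a : S) :
    greenHClass a = {x | x * inversion h x = a * inversion h a} ∩
      {x | inversion h x * x = inversion h a * a} := by
  ext x
  simp only [greenHClass, greenL_iff h, greenR_iff h, Set.mem_ofPred_eq, Set.mem_inter_iff]
  exact ⟨fun hx => ⟨hx.2.symm, hx.1.symm⟩, fun hx => ⟨hx.2.symm, hx.1.symm⟩⟩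

/-- The group of units of the local monoid `eSe`. -/
def unitSubgroup (e : S) : Subsemigroup S where
  carrier := {x | e * x = x ∧ x * e = x ∧ ∃ y, e * y = y ∧ y * e = y ∧ x * y = e ∧ y * x = e}
  mul_mem' := by
    rintro a b ⟨ha1, ha2, a', ha3, ha4, ha5, ha6⟩ ⟨hb1, hb2, b', hb3, hb4, hb5, hb6⟩
    refine ⟨by rw [← mul_assoc, ha1], by rw [mul_assoc, hb2], b' * a',
      by rw [← mul_assoc, hb3], by rw [mul_assoc, ha4], ?_, ?_⟩
    · rw [mul_assoc, ← mul_assoc b, hb5, ha3, ha5]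
    · rw [mul_assoc, ← mul_assoc a', ha6, hb1, hb6]

theorem isSubgroupOf_unitSubgroup {e : S} (he : IsIdempotentElem e) :
    IsSubgroupOf (unitSubgroup e) := by
  refine ⟨e, ⟨he, he, e, he, he, he, he⟩, ?_⟩
  rintro x ⟨hx1, hx2, y, hy1, hy2, hy3, hy4⟩
  exact ⟨hx1, hx2, y, ⟨hy1, hy2, x, hx1, hx2, hy4, hy3⟩, hy3, hy4⟩

theorem coe_unitSubgroup (h : IsInverseSemigroup S) {e : S} (he : IsIdempotentElem e) :
    (unitSubgroup e : Set S) = greenHClass e := by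
  rw [greenHClass_eq h, inversion_eq_self h he, he.eq]
  ext x
  constructor
  · rintro ⟨hx1, hx2, y, hy1, hy2, hy3, hy4⟩
    have : y = inversion h x := eq_inversion h (by rw [hy3, hx1]) (by rw [hy4, hy1])
    subst this
    exact ⟨hy3, hy4⟩
  · rintro ⟨hx1, hx2⟩
    simp only [Set.mem_ofPred_eq] at hx1 hx2
    refine ⟨?_, ?_, inversion h x, ?_, ?_, hx1, hx2⟩
    · rw [← hx1, mul_inversion_mul]
    · rw [← hx2, ← mul_assoc, mul_inversion_mul]
    · rw [← hx2, inversion_mul_inversion]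
    · rw [← hx1, ← mul_assoc, inversion_mul_inversion]

theorem IsMaximalSubgroup.exists_eq_unitSubgroup {H : Subsemigroup S} (hH : IsMaximalSubgroup H) :
    ∃ e : S, IsIdempotentElem e ∧ H = unitSubgroup e := by
  obtain ⟨e, heH, hg⟩ := hH.prop
  have he : IsIdempotentElem e := (hg e heH).1
  refine ⟨e, he, hH.eq_of_le (isSubgroupOf_unitSubgroup he) ?_⟩
  intro x hx
  obtain ⟨hx1, hx2, y, hy, hxy, hyx⟩ := hg x hx
  exact ⟨hx1, hx2, y, (hg y hy).1, (hg y hy).2.1, hxy, hyx⟩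

end Algebra

/-! ### Primitivity and the ideals `SeS` -/

section Primitive

variable {S : Type*} [Semigroup S]

theorem IsPrimitiveInverseSemigroup.eq_of_mul_eq (hp : IsPrimitiveInverseSemigroup S) {e f : S}
    (he : IsIdempotentElem e) (hf : IsIdempotentElem f) (hf0 : ¬ IsZeroElement f)
    (hef : e * f = f) : f = e := by
  have hfe : f * e = f := by rw [← idempotents_comm hp.2.1 he hf, hef]
  refine (hp.2.2 e he fun h0 => hf0 ?_).2.2 f hf hf0 ⟨hef, hfe⟩
  rw [← hef, (h0 f).1]
  exact h0

/-- The product is a non-zero idempotent below both factors, so it equals each of them. -/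
theorem IsPrimitiveInverseSemigroup.eq_of_mul_ne_zero (hp : IsPrimitiveInverseSemigroup S)
    {e f : S} (he : IsIdempotentElem e) (hf : IsIdempotentElem f)
    (hef : ¬ IsZeroElement (e * f)) : f = e := by
  have hi := isIdempotentElem_mul hp.2.1 he hf
  have h1 : e * f = e := hp.eq_of_mul_eq he hi hef (by rw [← mul_assoc, he.eq])
  have h2 : e * f = f := hp.eq_of_mul_eq hf hi hef
    (by rw [idempotents_comm hp.2.1 he hf, ← mul_assoc, hf.eq])
  exact h2.symm.trans h1

theorem not_isZeroElement_mul_inversion (h : IsInverseSemigroup S) {x : S}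
    (hx : ¬ IsZeroElement x) : ¬ IsZeroElement (x * inversion h x) := by
  intro h0
  apply hx
  rw [← mul_inversion_mul h x, (h0 x).1]
  exact h0

theorem not_isZeroElement_inversion_mul (h : IsInverseSemigroup S) {x : S}
    (hx : ¬ IsZeroElement x) : ¬ IsZeroElement (inversion h x * x) := by
  intro h0
  apply hx
  rw [← mul_inversion_mul h x, mul_assoc, (h0 x).2]
  exact h0

/-- The ideal `SeS`, as a subsemigroup. -/
def principalIdeal (e : S) : Subsemigroup S where
  carrier := {x | ∃ s t, x = s * e * t}
  mul_mem' := by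
    rintro _ _ ⟨s, t, rfl⟩ ⟨u, v, rfl⟩
    exact ⟨s, t * (u * e * v), by simp only [mul_assoc]⟩

theorem mul_mem_principalIdeal_left {e x : S} (hx : x ∈ principalIdeal e) (y : S) :
    y * x ∈ principalIdeal e := by
  obtain ⟨s, t, rfl⟩ := hx
  exact ⟨y * s, t, by simp only [mul_assoc]⟩

theorem mul_mem_principalIdeal_right {e x : S} (hx : x ∈ principalIdeal e) (y : S) :
    x * y ∈ principalIdeal e := by
  obtain ⟨s, t, rfl⟩ := hx
  exact ⟨s, t * y, by simp only [mul_assoc]⟩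

theorem self_mem_principalIdeal {e : S} (he : IsIdempotentElem e) : e ∈ principalIdeal e :=
  ⟨e, e, by rw [he.eq, he.eq]⟩

theorem isInverseSemigroup_principalIdeal (h : IsInverseSemigroup S) (e : S) :
    IsInverseSemigroup (principalIdeal e) := by
  rintro ⟨x, hx⟩
  have hi : inversion h x ∈ principalIdeal e := by
    rw [← inversion_mul_inversion h x]
    exact mul_mem_principalIdeal_right (mul_mem_principalIdeal_left hx _) _
  refine ⟨⟨inversion h x, hi⟩, ⟨Subtype.ext (mul_inversion_mul h x),
    Subtype.ext (inversion_mul_inversion h x)⟩, ?_⟩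
  rintro ⟨y, hy⟩ ⟨h1, h2⟩
  exact Subtype.ext (eq_inversion h (congrArg Subtype.val h1) (congrArg Subtype.val h2))

/-- If `s * e * t` is non-zero, then `e` has non-zero product with `t * t⁻¹` and with `s⁻¹ * s`, so
both equal `e`. Hence `s⁻¹` and `t⁻¹` serve as multipliers. -/
theorem exists_mul_mul_eq_of_mem_principalIdeal (hp : IsPrimitiveInverseSemigroup S) {z e x : S}
    (hz : IsZeroElement z) (he : IsIdempotentElem e) (hx : x ∈ principalIdeal e) (hxz : x ≠ z) :
    ∃ u v, u * x * v = e := by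
  obtain ⟨s, t, rfl⟩ := hx
  have hi := hp.2.1
  have ht : t * inversion hi t = e := by
    refine hp.eq_of_mul_ne_zero he (isIdempotentElem_mul_inversion hi t) fun h0 => hxz ?_
    have : s * e * t = s * (e * (t * inversion hi t)) * t := by
      simp only [mul_assoc]
      rw [← mul_assoc t, mul_inversion_mul]
    rw [this, h0.eq hz, (hz s).2, (hz t).1]
  have hs : inversion hi s * s = e := by
    refine hp.eq_of_mul_ne_zero he (isIdempotentElem_inversion_mul hi s) fun h0 => hxz ?_
    have : s * e * t = s * (e * (inversion hi s * s)) * t := by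
      rw [idempotents_comm hi he (isIdempotentElem_inversion_mul hi s), ← mul_assoc,
        ← mul_assoc, mul_inversion_mul]
    rw [this, h0.eq hz, (hz s).2, (hz t).1]
  refine ⟨inversion hi s, inversion hi t, ?_⟩
  rw [← mul_assoc, ← mul_assoc, hs, he.eq, mul_assoc, ht, he.eq]

theorem isBrandtSemigroup_principalIdeal (hp : IsPrimitiveInverseSemigroup S) {z e : S}
    (hz : IsZeroElement z) (he : IsIdempotentElem e) (hez : e ≠ z) :
    IsBrandtSemigroup (principalIdeal e) := by
  have hzm : z ∈ principalIdeal e := ⟨z, e, by rw [(hz e).1, (hz e).1]⟩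
  have hem := self_mem_principalIdeal he
  have hz' : IsZeroElement (⟨z, hzm⟩ : principalIdeal e) := fun x =>
    ⟨Subtype.ext (hz x).1, Subtype.ext (hz x).2⟩
  refine ⟨isInverseSemigroup_principalIdeal hp.2.1 e, ⟨⟨z, hzm⟩, hz', ?_, ?_⟩, ⟨e, hem⟩, ?_, ?_, ?_⟩
  · refine ⟨⟨e, hem⟩, ⟨e, hem⟩, fun h0 => hez ?_⟩
    rw [← he.eq]
    exact congrArg Subtype.val h0
  · rintro I ⟨⟨a, ha⟩, hI⟩
    by_cases h0 : ∀ x ∈ I, x = ⟨z, hzm⟩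
    · left
      exact Set.eq_singleton_iff_unique_mem.2 ⟨h0 a ha ▸ ha, h0⟩
    · right
      push Not at h0
      obtain ⟨x, hxI, hxz⟩ := h0
      obtain ⟨u, v, huv⟩ := exists_mul_mul_eq_of_mem_principalIdeal hp hz he x.2
        (fun h1 => hxz (Subtype.ext h1))
      -- The multipliers `u`, `v` may lie outside `SeS`; `e * u` and `v * e` lie inside and do the
      -- same job.
      have heI : (⟨e, hem⟩ : principalIdeal e) ∈ I := by
        have h1 := (hI _ (hI x hxI ⟨e * u, mul_mem_principalIdeal_right hem u⟩).1
          ⟨v * e, mul_mem_principalIdeal_left hem v⟩).2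
        convert h1 using 1
        refine Subtype.ext ?_
        change e = e * u * x * (v * e)
        have : e * u * x * (v * e) = e * (u * x * v) * e := by simp only [mul_assoc]
        rw [this, huv, he.eq, he.eq]
      refine Set.eq_univ_of_forall ?_
      rintro ⟨_, s, t, rfl⟩
      have h1 := (hI _ (hI _ heI ⟨s * e, mul_mem_principalIdeal_left hem s⟩).1
        ⟨e * t, mul_mem_principalIdeal_right hem t⟩).2
      convert h1 using 1
      refine Subtype.ext ?_
      change s * e * t = s * e * e * (e * t)
      have : s * e * e * (e * t) = s * (e * e * e) * t := by simp only [mul_assoc]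
      rw [this, he.eq, he.eq]
  · exact Subtype.ext he
  · exact fun h0 => hez (congrArg Subtype.val (h0.eq hz'))
  · rintro ⟨f, hf⟩ hfi hf0 ⟨hef, -⟩
    refine Subtype.ext (hp.eq_of_mul_eq he (congrArg Subtype.val hfi) (fun h0 => hf0 ?_)
      (congrArg Subtype.val hef))
    have : f = z := h0.eq hz
    subst this
    exact hz'

theorem IsMaximalBrandtSubsemigroup.exists_eq_principalIdeal
    (hp : IsPrimitiveInverseSemigroup S) {T : Subsemigroup S}
    (hT : IsMaximalBrandtSubsemigroup T) :
    ∃ z e : S, IsZeroElement z ∧ IsIdempotentElem e ∧ e ≠ z ∧ T = principalIdeal e := by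
  obtain ⟨-, ⟨z, hz, -, hideal⟩, e, heT, he0, -⟩ := hT.prop
  have he : IsIdempotentElem (e : S) := congrArg Subtype.val heT
  have hzi : IsIdempotentElem (z : S) := congrArg Subtype.val (hz z).1
  have hne : e ≠ z := fun h0 => he0 (h0 ▸ hz)
  -- Otherwise `z` would be a non-zero idempotent of `S` below `e`, hence equal to `e`.
  have hzS : IsZeroElement (z : S) := by
    by_contra h0
    exact hne (Subtype.ext (hp.eq_of_mul_eq he hzi h0 (congrArg Subtype.val (hz e).2)).symm)
  have hneS : (e : S) ≠ z := fun h0 => hne (Subtype.ext h0)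
  refine ⟨z, e, hzS, he, hneS,
    hT.eq_of_le (isBrandtSemigroup_principalIdeal hp hzS he hneS) ?_⟩
  intro x hx
  -- This is `TeT`, formed inside `T`; it contains `e ≠ z`, so it is all of `T`, whence `T ⊆ SeS`.
  have hI : IsSemigroupIdeal (principalIdeal e : Set T) :=
    ⟨⟨e, self_mem_principalIdeal heT⟩, fun a ha s =>
      ⟨mul_mem_principalIdeal_left ha s, mul_mem_principalIdeal_right ha s⟩⟩
  rcases hideal _ hI with h0 | h0
  · exact absurd (h0 ▸ self_mem_principalIdeal heT : e ∈ ({z} : Set T)) hne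
  · obtain ⟨s, t, hst⟩ : (⟨x, hx⟩ : T) ∈ (principalIdeal e : Set T) := h0 ▸ Set.mem_univ _
    exact ⟨s, t, congrArg Subtype.val hst⟩

/-- Writing `f = s * e * t`, take `a = e * t * f`. It is non-zero because `f = s * a`, while `a *
a⁻¹` lies below `e` and `a⁻¹ * a` below `f`; primitivity gives equality. -/
theorem exists_inversion_eq_of_mem_principalIdeal (hp : IsPrimitiveInverseSemigroup S) {e f : S}
    (he : IsIdempotentElem e) (hf : IsIdempotentElem f) (hf0 : ¬ IsZeroElement f)
    (hfe : f ∈ principalIdeal e) :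
    ∃ a, a * inversion hp.2.1 a = e ∧ inversion hp.2.1 a * a = f := by
  obtain ⟨s, t, hst⟩ := hfe
  have hfa : f = s * (e * t * f) := by
    simp only [← mul_assoc]
    rw [← hst, hf.eq]
  have ha0 : ¬ IsZeroElement (e * t * f) := fun h0 => hf0 (by
    rw [hfa, (h0 s).2]; exact h0)
  refine ⟨e * t * f, ?_, ?_⟩
  · refine hp.eq_of_mul_eq he (isIdempotentElem_mul_inversion _ _)
      (not_isZeroElement_mul_inversion _ ha0) ?_
    simp only [← mul_assoc]
    rw [he.eq]
  · refine hp.eq_of_mul_eq hf (isIdempotentElem_inversion_mul _ _)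
      (not_isZeroElement_inversion_mul _ ha0) ?_
    rw [idempotents_comm hp.2.1 hf (isIdempotentElem_inversion_mul _ _)]
    simp only [mul_assoc]
    rw [hf.eq]

end Primitive

/-! ### Isolated idempotents, compactness and finiteness -/

section Topological

variable {S : Type*} [Semigroup S] [TopologicalSpace S]

theorem isClosed_setOf_isZeroElement [T1Space S] : IsClosed {x : S | IsZeroElement x} :=
  Set.Subsingleton.isClosed fun _ hx _ hy => hx.eq hy

open Filter Topology in
theorem IsPrimitiveInverseSemigroup.eventually_eq [T1Space S] [ContinuousMul S]
    (hp : IsPrimitiveInverseSemigroup S) {e : S} (he : IsIdempotentElem e)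
    (he0 : ¬ IsZeroElement e) : ∀ᶠ f in 𝓝 e, IsIdempotentElem f → f = e := by
  have ho : IsOpen {f : S | ¬ IsZeroElement (e * f)} :=
    (isClosed_setOf_isZeroElement.preimage (continuous_const_mul e)).isOpen_compl
  filter_upwards [ho.mem_nhds (show ¬ IsZeroElement (e * e) by rwa [he.eq])] with f hf hfi
  exact hp.eq_of_mul_ne_zero he hfi hf

theorem IsPrimitiveInverseSemigroup.isClopen_preimage [T1Space S] [ContinuousMul S]
    (hp : IsPrimitiveInverseSemigroup S) {X : Type*} [TopologicalSpace X] {φ : X → S}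
    (hφ : Continuous φ) (hφi : ∀ x, IsIdempotentElem (φ x)) {e : S} (he : IsIdempotentElem e)
    (he0 : ¬ IsZeroElement e) : IsClopen {x | φ x = e} := by
  refine ⟨isClosed_singleton.preimage hφ, isOpen_iff_mem_nhds.2 ?_⟩
  rintro x rfl
  filter_upwards [hφ.continuousAt.eventually (hp.eventually_eq he he0)] with y hy
  exact hy (hφi y)

open Classical in
-- Zero need not be isolated in `E(S)`, so `x ↦ x * x⁻¹` need not be locally constant. Collapsing
-- the values in `U` to `none` makes it so.
theorem finite_idempotents_diff [T1Space S] [ContinuousMul S]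
    (hp : IsPrimitiveInverseSemigroup S) (hpc : IsPseudocompactSpace S)
    (hc : Continuous (inversion hp.2.1)) {U : Set S} (hU : IsOpen U)
    (hzU : ∀ z, IsZeroElement z → z ∈ U) : (idempotents S \ U).Finite := by
  have hφ : Continuous fun x : S => x * inversion hp.2.1 x := continuous_id.mul hc
  have hφi := isIdempotentElem_mul_inversion hp.2.1
  let g : S → Option S := fun x =>
    if x * inversion hp.2.1 x ∈ U then none else some (x * inversion hp.2.1 x)
  have hg : IsLocallyConstant g := by
    refine (IsLocallyConstant.iff_eventually_eq g).2 fun x => ?_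
    by_cases hx : x * inversion hp.2.1 x ∈ U
    · filter_upwards [(hU.preimage hφ).mem_nhds hx] with y hy
      have hy' : y * inversion hp.2.1 y ∈ U := hy
      simp only [g, if_pos hx, if_pos hy']
    · filter_upwards [(hp.isClopen_preimage hφ hφi (hφi x) (fun h0 => hx (hzU _ h0))).isOpen.mem_nhds
        rfl] with y hy
      have hy' : y * inversion hp.2.1 y = x * inversion hp.2.1 x := hy
      simp only [g, hy']
  refine ((hpc.finite_range hg).preimage (f := some) (Option.some_injective S).injOn).subset ?_
  rintro e ⟨he, heU⟩
  refine ⟨e, ?_⟩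
  have he' : e * inversion hp.2.1 e = e := by
    rw [inversion_eq_self hp.2.1 he]; exact he
  simp only [g, he', if_neg heU]

theorem isCompact_idempotents [T1Space S] [ContinuousMul S]
    (hp : IsPrimitiveInverseSemigroup S) (hpc : IsPseudocompactSpace S)
    (hc : Continuous (inversion hp.2.1)) : IsCompact (idempotents S) := by
  by_cases hz : ∃ z : S, IsZeroElement z
  · obtain ⟨z, hz⟩ := hz
    refine isCompact_of_finite_subcover fun {ι} U hU hcov => ?_
    classical
    obtain ⟨i, hi⟩ := Set.mem_iUnion.1 (hcov (show z ∈ idempotents S from (hz z).1))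
    have hfin := finite_idempotents_diff hp hpc hc (hU i) fun w hw => hw.eq hz ▸ hi
    obtain ⟨t, ht⟩ := hfin.isCompact.elim_finite_subcover U hU (Set.sdiff_subset.trans hcov)
    refine ⟨insert i t, fun x hx => ?_⟩
    by_cases hxi : x ∈ U i
    · exact Set.mem_biUnion (Finset.mem_insert_self i t) hxi
    · obtain ⟨j, hj, hxj⟩ := Set.mem_iUnion₂.1 (ht ⟨hx, hxi⟩)
      exact Set.mem_biUnion (Finset.mem_insert_of_mem hj) hxj
  -- Without a zero, `U = ∅` is allowed and `E(S)` itself is finite.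
  · have := finite_idempotents_diff hp hpc hc isOpen_empty fun z h0 => (hz ⟨z, h0⟩).elim
    rw [Set.sdiff_empty] at this
    exact this.isCompact

open Classical in
theorem finite_idempotents_principalIdeal [T1Space S] [ContinuousMul S]
    (hp : IsPrimitiveInverseSemigroup S) (hpc : IsPseudocompactSpace S)
    (hc : Continuous (inversion hp.2.1)) {e : S} (he : IsIdempotentElem e)
    (he0 : ¬ IsZeroElement e) : {f | f ∈ principalIdeal e ∧ IsIdempotentElem f}.Finite := by
  have hφ : Continuous fun x : S => x * inversion hp.2.1 x := continuous_id.mul hc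
  have hψ : Continuous fun x : S => inversion hp.2.1 x * x := hc.mul continuous_id
  have hφi := isIdempotentElem_mul_inversion hp.2.1
  have hψi := isIdempotentElem_inversion_mul hp.2.1
  have hR := hp.isClopen_preimage hφ hφi he he0
  -- The value `e` off the clopen fibre is arbitrary; on the fibre `x⁻¹ * x` is never zero, so `g`
  -- is locally constant.
  let g : S → S := fun x =>
    if x * inversion hp.2.1 x = e then inversion hp.2.1 x * x else e
  have hg : IsLocallyConstant g := by
    refine (IsLocallyConstant.iff_eventually_eq g).2 fun x => ?_
    by_cases hx : x * inversion hp.2.1 x = e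
    · have hx0 : ¬ IsZeroElement x := fun h0 => he0 (by
        rw [← hx, (h0 _).1]; exact h0)
      filter_upwards [hR.isOpen.mem_nhds hx, (hp.isClopen_preimage hψ hψi (hψi x)
        (not_isZeroElement_inversion_mul _ hx0)).isOpen.mem_nhds rfl] with y hy hy2
      have hy' : y * inversion hp.2.1 y = e := hy
      simp only [g, if_pos hx, if_pos hy']
      exact hy2
    · filter_upwards [hR.isClosed.isOpen_compl.mem_nhds hx] with y hy
      have hy' : ¬ y * inversion hp.2.1 y = e := hy
      simp only [g, if_neg hx, if_neg hy']
  have hz : {z : S | IsZeroElement z}.Finite :=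
    Set.Subsingleton.finite fun _ hx _ hy => hx.eq hy
  refine ((hpc.finite_range hg).union hz).subset ?_
  rintro f ⟨hfe, hf⟩
  by_cases hf0 : IsZeroElement f
  · exact Or.inr hf0
  · obtain ⟨a, ha1, ha2⟩ := exists_inversion_eq_of_mem_principalIdeal hp he hf hf0 hfe
    exact Or.inl ⟨a, by simp only [g, if_pos ha1, ha2]⟩

theorem isPseudocompactSpace_principalIdeal [T1Space S] [ContinuousMul S]
    (hp : IsPrimitiveInverseSemigroup S) (hpc : IsPseudocompactSpace S)
    (hc : Continuous (inversion hp.2.1)) {z e : S} (hz : IsZeroElement z)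
    (he : IsIdempotentElem e) (hez : e ≠ z) : IsPseudocompactSpace (principalIdeal e) := by
  have hfin := finite_idempotents_principalIdeal hp hpc hc he fun h0 => hez (h0.eq hz)
  have hφ : Continuous fun x : S => x * inversion hp.2.1 x := continuous_id.mul hc
  have hclopen : IsClopen (⋃ f ∈ {f | f ∈ principalIdeal e ∧ IsIdempotentElem f} \ {z},
      {x | x * inversion hp.2.1 x = f}) :=
    (hfin.subset Set.sdiff_subset).isClopen_biUnion fun f hf =>
      hp.isClopen_preimage hφ (isIdempotentElem_mul_inversion hp.2.1) hf.1.2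
        fun h0 => hf.2 (h0.eq hz)
  -- Zero is split off because its fibre need not be open.
  have heq : (principalIdeal e : Set S) =
      (⋃ f ∈ {f | f ∈ principalIdeal e ∧ IsIdempotentElem f} \ {z},
        {x | x * inversion hp.2.1 x = f}) ∪ {z} := by
    ext x
    constructor
    · intro hx
      by_cases hxz : x = z
      · exact Or.inr hxz
      · refine Or.inl (Set.mem_biUnion (x := x * inversion hp.2.1 x) ⟨⟨?_, ?_⟩, fun h0 => ?_⟩ rfl)
        · exact mul_mem_principalIdeal_right hx _
        · exact isIdempotentElem_mul_inversion _ _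
        · refine not_isZeroElement_mul_inversion hp.2.1 (fun h1 => hxz (h1.eq hz)) ?_
          rw [Set.mem_singleton_iff.1 h0]
          exact hz
    · rintro (hx | rfl)
      · obtain ⟨f, hf, hxf⟩ := Set.mem_iUnion₂.1 hx
        have hxf' : x * inversion hp.2.1 x = f := hxf
        have := mul_mem_principalIdeal_right hf.1.1 x
        rwa [← hxf', mul_inversion_mul] at this
      · exact ⟨x, e, by rw [(hz e).1, (hz e).1]⟩
  change IsPseudocompactSpace (principalIdeal e : Set S)
  rw [heq]
  exact (hpc.of_isClopen hclopen).union isPseudocompactSpace_of_finite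

theorem isClopen_greenHClass [T1Space S] [ContinuousMul S]
    (hp : IsPrimitiveInverseSemigroup S) (hc : Continuous (inversion hp.2.1)) {a : S}
    (ha : ¬ IsZeroElement a) : IsClopen (greenHClass a) := by
  rw [greenHClass_eq hp.2.1]
  exact (hp.isClopen_preimage (continuous_id.mul hc) (isIdempotentElem_mul_inversion hp.2.1)
    (isIdempotentElem_mul_inversion _ a) (not_isZeroElement_mul_inversion _ ha)).inter
    (hp.isClopen_preimage (hc.mul continuous_id) (isIdempotentElem_inversion_mul hp.2.1)
      (isIdempotentElem_inversion_mul _ a) (not_isZeroElement_inversion_mul _ ha))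

end Topological

end PseudocompactPrimitive

theorem proposition2p1 (S : Type*) [Semigroup S] [TopologicalSpace S]
    (hS : IsTopologicalInverseSemigroup S)
    (hprim : IsPrimitiveInverseSemigroup S)
    (hpc : IsPseudocompactSpace S) :
    -- non-zero idempotents are isolated in `E(S)`, and `E(S)` is a compact semilattice
    ((∀ e : idempotents S, ¬ IsZeroElement (e : S) → IsOpen ({e} : Set (idempotents S))) ∧
      IsCompact (idempotents S) ∧
      (∀ e ∈ idempotents S, ∀ f ∈ idempotents S, e * f ∈ idempotents S ∧ e * f = f * e)) ∧
    -- non-zero `H`-classes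
    (∀ a : S, ¬ IsZeroElement a →
      IsClopen (greenHClass a) ∧ IsPseudocompactSpace (greenHClass a)) ∧
    -- maximal subgroups
    (∀ H : Subsemigroup S, IsMaximalSubgroup H → IsPseudocompactSpace H) ∧
    -- maximal Brandt subsemigroups
    (∀ T : Subsemigroup S, IsMaximalBrandtSubsemigroup T →
      IsPseudocompactSpace T ∧ {e : S | e ∈ T ∧ IsIdempotentElem e}.Finite) := by
  obtain ⟨_, _, hI, hc⟩ := hS
  have hi : IsInverseSemigroup S := hprim.2.1
  have hc : Continuous (inversion hprim.2.1) := hc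
  refine ⟨⟨?_, isCompact_idempotents hprim hpc hc, fun e he f hf =>
    ⟨isIdempotentElem_mul hi he hf, idempotents_comm hi he hf⟩⟩, ?_, ?_, ?_⟩
  · intro e he0
    have := (hprim.isClopen_preimage continuous_subtype_val (fun x : idempotents S => x.2) e.2
      he0).isOpen
    convert this using 1
    ext x
    exact Subtype.ext_iff
  · exact fun a ha => ⟨isClopen_greenHClass hprim hc ha,
      hpc.of_isClopen (isClopen_greenHClass hprim hc ha)⟩
  · intro H hH
    obtain ⟨e, he, rfl⟩ := hH.exists_eq_unitSubgroup
    by_cases he0 : IsZeroElement e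
    -- The `H`-class of zero need not be open, but this group is trivial.
    · have : Subsingleton (unitSubgroup e) := ⟨fun x y => Subtype.ext (by
        rw [← x.2.1, ← y.2.1, (he0 x).1, (he0 y).1])⟩
      exact isPseudocompactSpace_of_finite
    · change IsPseudocompactSpace (unitSubgroup e : Set S)
      rw [coe_unitSubgroup hi he]
      exact hpc.of_isClopen (isClopen_greenHClass hprim hc he0)
  · intro T hT
    obtain ⟨z, e, hz, he, hez, rfl⟩ := hT.exists_eq_principalIdeal hprim
    exact ⟨isPseudocompactSpace_principalIdeal hprim hpc hc hz he hez,
      finite_idempotents_principalIdeal hprim hpc hc he fun h0 => hez (h0.eq hz)⟩
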